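/- Let $\omega=\frac{-1+\sqrt{-3}}{2}$. For a prime $p>3$ let $\mathbb Z_p$ be the ring of rational numbers whose denominator is not divisible by $p$; for $x,y\in\mathbb Q$ write $x\equiv y \pmod p$ if $x-y\in p\mathbb Z_p$. For a prime $\pi$ of $\mathbb Z[\omega]$ with norm $N\pi$ and $\pi\nmid 3$, and for $\alpha\in\mathbb Z[\omega]$, let $\left(\frac{\alpha}{\pi}\right)_3=0$ if $\pi\mid\alpha$, and otherwise let $\left(\frac{\alpha}{\pi}\right)_3$ be the element of $\{1,\omega,\omega^2\}$ congruent to $\alpha^{(N\pi-1)/3}$ modulo $\pi$. Let $\left(\frac{\alpha}{p}\right)_3$ be the cubic Jacobi symbol, that is, the product of $\left(\frac{\alpha}{\pi}\right)_3$ over the prime factors $\pi$ of $p$ in $\mathbb Z[\omega]$, counted with multiplicity; extend it to $\alpha/d$ with $\alpha\in\mathbb Z[\omega]$, $d\in\mathbb Z$, $p\nmid d$, by $\left(\frac{\alpha/d}{p}\right)_3=\left(\frac{\alpha}{p}\right)_3\left(\frac{d}{p}\right)_3^{-1}$. For $r\in\{0,1,2\}$ let $C_r(p)$ be the set of $c\in\mathbb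 Z_p$ with $c^2+3\not\equiv 0\pmod p$ and $\left(\frac{c+1+2\omega}{p}\right)_3=\omega^r$. **Theorem 2.5.** Let $p>3$ be a prime and let $c\in\mathbb Z_p$ satisfy $c(c^2+3)\not\equiv 0\pmod p$. Then $c$ belongs to one of $C_0(p),C_1(p),C_2(p)$, and $$\sum_{k=1}^{[p/3]}\binom{3k}{k}\left(\frac{4}{9(c^2+3)}\right)^k\equiv\begin{cases}0 \pmod p&\text{if } c\in C_0(p),\\[2pt] -\dfrac{3(c+1)}{2c}\pmod p&\text{if } c\in C_1(p),\\[4pt] -\dfrac{3(c-1)}{2c}\pmod p&\text{if } c\in C_2(p),\end{cases}$$ where $[x]$ is the greatest integer not exceeding $x$. -/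

import Mathlib

/-- The ring `ℤ[ω]` of Eisenstein integers `x + y ω`, where `ω ^ 2 = -1 - ω`. -/
abbrev EisensteinInt : Type := QuadraticAlgebra ℤ (-1) (-1)

/-- The field `ℚ(ω)`, with elements `x + y ω`, where `ω ^ 2 = -1 - ω`. -/
abbrev EisensteinRat : Type := QuadraticAlgebra ℚ (-1) (-1)

namespace EisensteinInt

/-- The primitive cube root of unity `ω = (-1 + √-3) / 2` in `ℤ[ω]`. -/
def ω : EisensteinInt := ⟨0, 1⟩

/-- The absolute norm `N(x + y ω) = x ^ 2 - x y + y ^ 2`, as a natural number. -/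
def absNorm (z : EisensteinInt) : ℕ := (QuadraticAlgebra.norm z).natAbs

theorem norm_eq (z : EisensteinInt) :
    QuadraticAlgebra.norm z = z.re ^ 2 - z.re * z.im + z.im ^ 2 := by
  rw [QuadraticAlgebra.norm_def]; ring

theorem norm_nonneg (z : EisensteinInt) : 0 ≤ QuadraticAlgebra.norm z := by
  rw [norm_eq]; nlinarith [sq_nonneg (z.re - z.im), sq_nonneg z.re, sq_nonneg z.im]

theorem norm_pos {z : EisensteinInt} (hz : z ≠ 0) : 0 < QuadraticAlgebra.norm z := by
  refine lt_of_le_of_ne (norm_nonneg z) fun h => hz ?_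
  rw [norm_eq] at h
  have h1 : z.re = 0 := by
    nlinarith [sq_nonneg (z.re - 2 * z.im), sq_nonneg z.re]
  have h2 : z.im = 0 := by
    nlinarith [sq_nonneg (z.im - 2 * z.re), sq_nonneg z.im]
  exact QuadraticAlgebra.ext h1 h2

/-- Division with remainder in `ℤ[ω]`: round the coordinates of `x / y` to nearest integers. -/
def quot (x y : EisensteinInt) : EisensteinInt :=
  ⟨round (((x * star y).re : ℚ) / (QuadraticAlgebra.norm y : ℤ)),
    round (((x * star y).im : ℚ) / (QuadraticAlgebra.norm y : ℤ))⟩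

theorem norm_rem_lt (x : EisensteinInt) {y : EisensteinInt} (hy : y ≠ 0) :
    QuadraticAlgebra.norm (x - y * quot x y) < QuadraticAlgebra.norm y := by
  have hn := norm_pos hy
  set n := QuadraticAlgebra.norm y with hn_def
  set w := x * star y with hw
  set a : ℤ := round ((w.re : ℚ) / (n : ℤ)) with ha
  set b : ℤ := round ((w.im : ℚ) / (n : ℤ)) with hb
  have hq : quot x y = ⟨a, b⟩ := rfl
  have hnq : (0 : ℚ) < n := by exact_mod_cast hn
  have key : n * QuadraticAlgebra.norm (x - y * quot x y) =
      (w.re - n * a) ^ 2 - (w.re - n * a) * (w.im - n * b) + (w.im - n * b) ^ 2 := by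
    have h1 : (x - y * quot x y) * star y = ⟨w.re - n * a, w.im - n * b⟩ := by
      rw [hq, hn_def, norm_eq, hw]
      ext
      · simp; ring
      · simp; ring
    have h2 := congrArg QuadraticAlgebra.norm h1
    rw [map_mul, QuadraticAlgebra.norm_star, norm_eq (⟨w.re - n * a, w.im - n * b⟩)] at h2
    rw [mul_comm]; exact h2
  have e1 := abs_le.1 (abs_sub_round ((w.re : ℚ) / (n : ℤ)))
  have e2 := abs_le.1 (abs_sub_round ((w.im : ℚ) / (n : ℤ)))
  rw [← ha] at e1
  rw [← hb] at e2
  set s : ℚ := (w.re : ℚ) / (n : ℤ) - a with hs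
  set t : ℚ := (w.im : ℚ) / (n : ℤ) - b with ht
  have hs' : ((w.re - n * a : ℤ) : ℚ) = n * s := by
    rw [hs]; push_cast; field_simp
  have ht' : ((w.im - n * b : ℤ) : ℚ) = n * t := by
    rw [ht]; push_cast; field_simp
  have hst : s ^ 2 - s * t + t ^ 2 < 1 := by
    nlinarith [sq_nonneg (s + t), mul_nonneg (sub_nonneg.2 e1.2) (neg_le_iff_add_nonneg.1 e1.1),
      mul_nonneg (sub_nonneg.2 e2.2) (neg_le_iff_add_nonneg.1 e2.1)]
  have hlt : ((n * QuadraticAlgebra.norm (x - y * quot x y) : ℤ) : ℚ) < ((n * n : ℤ) : ℚ) := by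
    rw [key]
    have : (((w.re - n * a) ^ 2 - (w.re - n * a) * (w.im - n * b) + (w.im - n * b) ^ 2 : ℤ) : ℚ)
        = n * n * (s ^ 2 - s * t + t ^ 2) := by
      rw [Int.cast_add, Int.cast_sub, Int.cast_mul, Int.cast_pow, Int.cast_pow, hs', ht']; ring
    rw [this]
    push_cast
    nlinarith [mul_pos hnq hnq]
  have hlt' : n * QuadraticAlgebra.norm (x - y * quot x y) < n * n := by exact_mod_cast hlt
  exact lt_of_mul_lt_mul_left hlt' hn.le

/-- `ℤ[ω]` is norm-Euclidean; in particular it is a unique factorization domain. -/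
instance instEuclideanDomain : EuclideanDomain EisensteinInt where
  quotient := quot
  quotient_zero x := by
    ext <;> simp [quot]
  remainder x y := x - y * quot x y
  quotient_mul_add_remainder_eq x y := by ring
  r x y := absNorm x < absNorm y
  r_wellFounded := (measure absNorm).wf
  remainder_lt x y hy := by
    have h := norm_rem_lt x hy
    have h0 := norm_nonneg (x - y * quot x y)
    unfold absNorm
    omega
  mul_left_not_lt x y hy := by
    have h := Nat.pos_of_ne_zero (Int.natAbs_ne_zero.2 (norm_pos hy).ne')
    simp only [absNorm, map_mul, Int.natAbs_mul, not_lt]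
    exact Nat.le_mul_of_pos_right _ h

open Classical in
/-- The cubic residue symbol `(α / π)₃` for a prime `π` of `ℤ[ω]` that does not divide `3`: it is
`0` if `π ∣ α`, and otherwise the cube root of unity `ω ^ r` with
`α ^ ((N π - 1) / 3) ≡ ω ^ r (mod π)`. -/
noncomputable def cubicResidueSymbol (α π : EisensteinInt) : EisensteinInt :=
  if π ∣ α then 0
  else if π ∣ α ^ ((absNorm π - 1) / 3) - 1 then 1
  else if π ∣ α ^ ((absNorm π - 1) / 3) - ω then ω
  else if π ∣ α ^ ((absNorm π - 1) / 3) - ω ^ 2 then ω ^ 2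
  else 0

/-- The cubic Jacobi symbol `(α / β)₃` for `α, β` in `ℤ[ω]`, with `β` nonzero and coprime to `3`:
the product of the cubic residue symbols `(α / π)₃` over the prime factors `π` of `β`, counted
with multiplicity (the symbol `(α / π)₃` depends on `π` only up to units). -/
noncomputable def cubicJacobiSymbol (α β : EisensteinInt) : EisensteinInt :=
  ((UniqueFactorizationMonoid.factors β).map (cubicResidueSymbol α)).prod

/-- The cubic Jacobi symbol `(x / β)₃` for `x` in `ℚ(ω)` whose denominator is coprime to `β`.
It extends the symbol on `ℤ[ω]` multiplicatively: write `x = α / d` with `α` in `ℤ[ω]` and `d` a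
positive integer, and put `(x / β)₃ = (α / β)₃ (d / β)₃⁻¹ = (α / β)₃ (d / β)₃ ^ 2`, the last step
because `(d / β)₃` is a cube root of unity. Here `d` is the product of the denominators of the two
coordinates of `x`. -/
noncomputable def cubicJacobiSymbolRat (x : EisensteinRat) (β : EisensteinInt) : EisensteinInt :=
  cubicJacobiSymbol ⟨x.re.num * x.im.den, x.im.num * x.re.den⟩ β *
    cubicJacobiSymbol ((x.re.den * x.im.den : ℕ) : EisensteinInt) β ^ 2

end EisensteinInt

/-- `x` lies in `ℤ_p`, the ring of rational numbers whose denominator is not divisible by `p`. -/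
def IsPIntegral (p : ℕ) (x : ℚ) : Prop := ¬ p ∣ x.den

/-- The congruence `x ≡ y (mod p)` between rational numbers: `x - y` lies in `p ℤ_p`. -/
def RatModEq (p : ℕ) (x y : ℚ) : Prop := ∃ z : ℚ, IsPIntegral p z ∧ x - y = p * z

/-- The set `C_r(p)` of those `c` in `ℤ_p` with `c ^ 2 + 3 ≢ 0 (mod p)` for which
`((c + 1 + 2 ω) / p)₃ = ω ^ r`. -/
def cubicClass (r p : ℕ) : Set ℚ :=
  {c | IsPIntegral p c ∧ ¬ RatModEq p (c ^ 2 + 3) 0 ∧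
    EisensteinInt.cubicJacobiSymbolRat ⟨c + 1, 2⟩ (p : EisensteinInt) = EisensteinInt.ω ^ r}

/-! Put n = [p/3] and work in a residue field K of ℤ[ω] above p. Since 9n(n+1) = -2 in K, the term
ratios give C(3k,k) = C(n+k,2k)(-27)^k for k ≤ n (`choose_three_mul_eq`), so 1 plus the sum is the
Morgan-Voyce value b_n(-27t), with t = 4/(9(c²+3)). With s = 1+2ω, s² = -3 and v = (c+s)/(c-s), one
has -27t = (v-1)²/v, and `morganVoyce_closed_form` gives (v+1)b_n = v^(n+1) + v^(-n).

The cubic symbol ρ of c+s is v^n if p ≡ 1 (mod 3) and v^(-(n+1)) if p ≡ 2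
(`exists_field_map_cubicJacobiSymbol`). Both cases yield vρ + ρ⁻¹, so the sum is ((c+s)ρ +
(c-s)ρ⁻¹)/(2c) - 1 (`sum_choose_three_mul_eq`); it remains to insert ρ = 1, ω, ω². -/

/-! ### Reduction of rational numbers to a field of characteristic p -/

/-- The rational number `x` is a quotient of integers, with denominator invertible in `K`, whose
value in `K` is `k`. -/
def Rat.ReducesTo {K : Type*} [Field K] (x : ℚ) (k : K) : Prop :=
  ∃ a d : ℤ, (d : K) ≠ 0 ∧ x * d = a ∧ k * d = a

namespace Rat.ReducesTo

variable {K : Type*} [Field K] {x y : ℚ} {k l : K}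

theorem intCast (a : ℤ) : ReducesTo (a : ℚ) (a : K) := ⟨a, 1, by simp, by simp, by simp⟩

theorem natCast (a : ℕ) : ReducesTo (a : ℚ) (a : K) := by
  simpa using intCast (K := K) a

theorem ofNat (a : ℕ) [a.AtLeastTwo] :
    ReducesTo (OfNat.ofNat a : ℚ) (OfNat.ofNat a : K) := by
  exact_mod_cast natCast (K := K) (OfNat.ofNat a)

theorem zero : ReducesTo (0 : ℚ) (0 : K) := by simpa using natCast (K := K) 0

theorem one : ReducesTo (1 : ℚ) (1 : K) := by simpa using natCast (K := K) 1

theorem add (hx : x.ReducesTo k) (hy : y.ReducesTo l) : (x + y).ReducesTo (k + l) := by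
  obtain ⟨a, d, hd, h1, h2⟩ := hx
  obtain ⟨a', d', hd', h1', h2'⟩ := hy
  refine ⟨a * d' + a' * d, d * d', ?_, ?_, ?_⟩
  · push_cast; exact mul_ne_zero hd hd'
  · push_cast; rw [← h1, ← h1']; ring
  · push_cast; rw [← h2, ← h2']; ring

theorem neg (hx : x.ReducesTo k) : (-x).ReducesTo (-k) := by
  obtain ⟨a, d, hd, h1, h2⟩ := hx
  exact ⟨-a, d, hd, by push_cast; rw [← h1]; ring, by push_cast; rw [← h2]; ring⟩

theorem sub (hx : x.ReducesTo k) (hy : y.ReducesTo l) : (x - y).ReducesTo (k - l) := by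
  simpa only [sub_eq_add_neg] using hx.add hy.neg

theorem mul (hx : x.ReducesTo k) (hy : y.ReducesTo l) : (x * y).ReducesTo (k * l) := by
  obtain ⟨a, d, hd, h1, h2⟩ := hx
  obtain ⟨a', d', hd', h1', h2'⟩ := hy
  refine ⟨a * a', d * d', ?_, ?_, ?_⟩
  · push_cast; exact mul_ne_zero hd hd'
  · push_cast; rw [← h1, ← h1']; ring
  · push_cast; rw [← h2, ← h2']; ring

theorem inv (hx : x.ReducesTo k) (hk : k ≠ 0) : (x⁻¹).ReducesTo (k⁻¹) := by
  obtain ⟨a, d, hd, h1, h2⟩ := hx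
  have ha : (a : K) ≠ 0 := h2 ▸ mul_ne_zero hk hd
  have ha' : (a : ℚ) ≠ 0 := by
    intro h
    rw [Int.cast_eq_zero] at h
    exact ha (by rw [h, Int.cast_zero])
  have hx0 : x ≠ 0 := by
    rintro rfl
    exact ha' (by rw [← h1, zero_mul])
  refine ⟨d, a, ha, ?_, ?_⟩
  · rw [← h1, inv_mul_cancel_left₀ hx0]
  · rw [← h2, inv_mul_cancel_left₀ hk]

theorem div (hx : x.ReducesTo k) (hy : y.ReducesTo l) (hl : l ≠ 0) :
    (x / y).ReducesTo (k / l) := by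
  simpa only [div_eq_mul_inv] using hx.mul (hy.inv hl)

theorem pow (hx : x.ReducesTo k) (n : ℕ) : (x ^ n).ReducesTo (k ^ n) := by
  induction n with
  | zero => simpa using one
  | succ n ih => simpa only [pow_succ] using ih.mul hx

theorem sum {ι : Type*} (s : Finset ι) {f : ι → ℚ} {g : ι → K}
    (h : ∀ i ∈ s, (f i).ReducesTo (g i)) : (∑ i ∈ s, f i).ReducesTo (∑ i ∈ s, g i) := by
  classical
  induction s using Finset.induction_on with
  | empty => simpa using zero
  | insert i s hi ih =>
    rw [Finset.sum_insert hi, Finset.sum_insert hi]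
    exact (h i (by simp)).add (ih fun j hj => h j (by simp [hj]))

/-- The difference is a/d with d invertible in K and a zero in K, so p divides a but not d. This
brings identities in K back to congruences. -/
theorem ratModEq {p : ℕ} [CharP K p] (hx : x.ReducesTo k) (hy : y.ReducesTo k) :
    RatModEq p x y := by
  obtain ⟨a, d, hd, h1, h2⟩ := hx.sub hy
  rw [sub_self, zero_mul, eq_comm, CharP.intCast_eq_zero_iff K p] at h2
  obtain ⟨m, rfl⟩ := h2
  have hd0 : (d : ℚ) ≠ 0 := by
    intro h
    rw [Int.cast_eq_zero] at h
    exact hd (by rw [h, Int.cast_zero])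
  refine ⟨m / d, fun h => hd ?_, ?_⟩
  · rw [CharP.intCast_eq_zero_iff K p]
    exact (Int.natCast_dvd_natCast.2 h).trans (Rat.divInt_eq_div m d ▸ Rat.den_dvd m d)
  · rw [← mul_div_assoc, eq_div_iff hd0, h1]
    push_cast
    rfl

theorem isPIntegral_mul {p : ℕ} (hp : p.Prime) (hx : IsPIntegral p x) (hy : IsPIntegral p y) :
    IsPIntegral p (x * y) := fun h =>
  (hp.dvd_mul.1 (h.trans (Rat.mul_den_dvd x y))).elim hx hy

end Rat.ReducesTo

/-! ### Morgan-Voyce polynomials -/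

section MorganVoyce

/-- The Morgan-Voyce polynomials `b_n`. -/
def morganVoyceB {R : Type*} [CommRing R] (n : ℕ) (y : R) : R :=
  ∑ k ∈ Finset.range (n + 1), ((n + k).choose (2 * k) : R) * y ^ k

/-- The Morgan-Voyce polynomials `B_n`. -/
def morganVoyceB' {R : Type*} [CommRing R] (n : ℕ) (y : R) : R :=
  ∑ k ∈ Finset.range (n + 1), ((n + k + 1).choose (2 * k + 1) : R) * y ^ k

variable {R : Type*} [CommRing R]

theorem morganVoyceB_succ (n : ℕ) (y : R) :
    morganVoyceB (n + 1) y = y * morganVoyceB' n y + morganVoyceB n y := by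
  have h : morganVoyceB n y =
      ∑ k ∈ Finset.range (n + 2), ((n + k).choose (2 * k) : R) * y ^ k := by
    rw [Finset.sum_range_succ, Nat.choose_eq_zero_of_lt (by lia)]
    simp [morganVoyceB]
  rw [h, morganVoyceB, morganVoyceB', Finset.sum_range_succ', Finset.sum_range_succ' _ (n + 1),
    Finset.mul_sum, ← add_assoc, ← Finset.sum_add_distrib]
  congr 1
  · refine Finset.sum_congr rfl fun k _ => ?_
    have : n + 1 + (k + 1) = (n + k + 1) + 1 := by ring
    rw [this, show 2 * (k + 1) = (2 * k + 1) + 1 by ring, Nat.choose_succ_succ, ← add_assoc n k 1]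
    push_cast
    ring
  · simp

theorem morganVoyceB'_succ (n : ℕ) (y : R) :
    morganVoyceB' (n + 1) y = morganVoyceB' n y + morganVoyceB (n + 1) y := by
  have h : morganVoyceB' n y =
      ∑ k ∈ Finset.range (n + 2), ((n + k + 1).choose (2 * k + 1) : R) * y ^ k := by
    rw [Finset.sum_range_succ, Nat.choose_eq_zero_of_lt (by lia)]
    simp [morganVoyceB']
  rw [h, morganVoyceB, morganVoyceB', ← Finset.sum_add_distrib]
  refine Finset.sum_congr rfl fun k _ => ?_
  rw [Nat.choose_succ_succ, show n + 1 + k = n + k + 1 by ring]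
  push_cast
  ring

/-- The recursions for b_n and B_n feed each other, so both formulas go through one induction. -/
theorem morganVoyce_closed_form {K : Type*} [Field K] {v y : K} (hv : v ≠ 0)
    (hy : y * v = (v - 1) ^ 2) (n : ℕ) :
    (v + 1) * morganVoyceB n y = v ^ (n + 1) + (v ^ n)⁻¹ ∧
      (v ^ 2 - 1) * morganVoyceB' n y = v ^ (n + 2) - (v ^ n)⁻¹ := by
  obtain rfl : y = (v - 1) ^ 2 / v := by rw [eq_div_iff hv, hy]
  induction n with
  | zero => simp [morganVoyceB, morganVoyceB']
  | succ n ih =>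
    have h : (v + 1) * morganVoyceB (n + 1) ((v - 1) ^ 2 / v) =
        v ^ (n + 1 + 1) + (v ^ (n + 1))⁻¹ := by
      rw [morganVoyceB_succ]
      have : (v + 1) * ((v - 1) ^ 2 / v * morganVoyceB' n ((v - 1) ^ 2 / v) +
          morganVoyceB n ((v - 1) ^ 2 / v)) =
          (v - 1) / v * ((v ^ 2 - 1) * morganVoyceB' n ((v - 1) ^ 2 / v)) +
          (v + 1) * morganVoyceB n ((v - 1) ^ 2 / v) := by ring
      rw [this, ih.1, ih.2]
      field_simp
      ring
    refine ⟨h, ?_⟩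
    rw [morganVoyceB'_succ, mul_add, ih.2]
    have : (v ^ 2 - 1) * morganVoyceB (n + 1) ((v - 1) ^ 2 / v) =
        (v - 1) * ((v + 1) * morganVoyceB (n + 1) ((v - 1) ^ 2 / v)) := by ring
    rw [this, h]
    field_simp
    ring

end MorganVoyce

/-! ### Binomial coefficients modulo p -/

-- The ratio of consecutive terms is (n+k+1)(n-k)/((2k+1)(2k+2)); moving the k part to the left
-- avoids truncated subtraction.
open scoped Nat in
theorem Nat.choose_add_two_mul_succ (n k : ℕ) :
    (n + (k + 1)).choose (2 * (k + 1)) * ((2 * k + 1) * (2 * k + 2)) +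
      (n + k).choose (2 * k) * (n + k + 1) * k = (n + k).choose (2 * k) * (n + k + 1) * n := by
  have h1 := Nat.add_one_mul_choose_eq (n + k) (2 * k + 1)
  have h2 := Nat.choose_succ_right_eq (n + k) (2 * k)
  rw [show n + (k + 1) = n + k + 1 by ring, show 2 * (k + 1) = 2 * k + 1 + 1 by ring]
  rcases le_or_gt k n with h | h
  · obtain ⟨m, rfl⟩ := Nat.exists_eq_add_of_le h
    rw [show k + m + k - 2 * k = m by lia] at h2
    linear_combination (2 * k + 1) * (-h1) + (k + m + k + 1) * h2
  · rw [Nat.choose_eq_zero_of_lt (by lia : n + k + 1 < 2 * k + 1 + 1),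
      Nat.choose_eq_zero_of_lt (by lia : n + k < 2 * k)]
    simp

open scoped Nat in
theorem Nat.choose_three_mul_succ (k : ℕ) :
    (3 * (k + 1)).choose (k + 1) * ((2 * k + 1) * (2 * k + 2)) =
      (3 * k).choose k * (3 * ((3 * k + 1) * (3 * k + 2))) := by
  have h1 := Nat.add_choose_mul_factorial_mul_factorial (2 * k) k
  have h2 := Nat.add_choose_mul_factorial_mul_factorial (2 * (k + 1)) (k + 1)
  rw [show 2 * k + k = 3 * k by ring] at h1
  rw [show 2 * (k + 1) + (k + 1) = 3 * (k + 1) by ring] at h2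
  rw [show 2 * (k + 1) = 2 * k + 1 + 1 by ring, show 3 * (k + 1) = 3 * k + 1 + 1 + 1 by ring] at h2
  simp only [Nat.factorial_succ] at h2
  rw [← h1] at h2
  rw [show 3 * (k + 1) = 3 * k + 1 + 1 + 1 by ring]
  have hpos : 0 < (2 * k)! * k ! * (k + 1) := by positivity
  apply Nat.eq_of_mul_eq_mul_right hpos
  linear_combination h2

/-- Both sides have the same term ratio: (n+k+1)(n-k) = n(n+1) - k(k+1) becomes -(3k+1)(3k+2)/9 in
K. -/
theorem choose_three_mul_eq {K : Type*} [Field K] {p : ℕ} [CharP K p] (hp : p.Prime)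
    (hp3 : 3 < p) {k : ℕ} (hk : k ≤ p / 3) :
    ((3 * k).choose k : K) = ((p / 3 + k).choose (2 * k) : K) * (-27) ^ k := by
  -- In K, 3n is -1 or -2, and either way 3n(3n+3) = -2.
  have key : (9 : K) * (p / 3 : ℕ) * ((p / 3 : ℕ) + 1) = -2 := by
    have h0 : p % 3 ≠ 0 := fun h => by
      have := (Nat.prime_dvd_prime_iff_eq Nat.prime_three hp).1 (Nat.dvd_of_mod_eq_zero h)
      lia
    have hcast : ((3 * (p / 3) + p % 3 : ℕ) : K) = 0 := by
      rw [Nat.div_add_mod, CharP.cast_eq_zero]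
    rcases (by lia : p % 3 = 1 ∨ p % 3 = 2) with h | h <;> rw [h] at hcast <;> push_cast at hcast
    · linear_combination (3 * ((p / 3 : ℕ) : K) + 2) * hcast
    · linear_combination (3 * ((p / 3 : ℕ) : K) + 1) * hcast
  induction k with
  | zero => simp
  | succ k ih =>
    have h1 := congrArg (Nat.cast (R := K)) (Nat.choose_add_two_mul_succ (p / 3) k)
    have h2 := congrArg (Nat.cast (R := K)) (Nat.choose_three_mul_succ k)
    have ih := ih (by lia)
    -- Here k + 1 ≤ p/3, so both factors are positive and below p.
    have hne : ((((2 * k + 1) * (2 * k + 2) : ℕ)) : K) ≠ 0 := by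
      rw [Ne, CharP.cast_eq_zero_iff K p, hp.dvd_mul, not_or]
      exact ⟨Nat.not_dvd_of_pos_of_lt (by lia) (by lia),
        Nat.not_dvd_of_pos_of_lt (by lia) (by lia)⟩
    apply mul_right_cancel₀ hne
    push_cast at h1 h2 ih key ⊢
    rw [pow_succ]
    linear_combination h2 + 3 * (3 * k + 1) * (3 * k + 2) * ih + 27 * (-27) ^ k * h1
      + 3 * ((p / 3 + k).choose (2 * k) : K) * (-27) ^ k * key

theorem one_add_sum_choose_three_mul {K : Type*} [Field K] {p : ℕ} [CharP K p] (hp : p.Prime)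
    (hp3 : 3 < p) (t : K) :
    1 + ∑ k ∈ Finset.Icc 1 (p / 3), ((3 * k).choose k : K) * t ^ k =
      morganVoyceB (p / 3) (-27 * t) := by
  rw [morganVoyceB, Finset.range_eq_Ico, Finset.sum_eq_sum_Ico_succ_bot (by lia)]
  congr 1
  · simp
  · refine Finset.sum_congr (by ext; simp) fun k hk => ?_
    rw [Finset.mem_Ico] at hk
    rw [choose_three_mul_eq hp hp3 (by lia), mul_pow]
    ring

/-! ### Arithmetic of ℤ[ω] and the factorization of p -/

namespace EisensteinInt

@[simp]
theorem re_one_eq : (1 : EisensteinInt).re = 1 := rfl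

@[simp]
theorem im_one_eq : (1 : EisensteinInt).im = 0 := rfl

theorem ω_sq : ω ^ 2 = -1 - ω := by
  ext <;> simp [ω, pow_two]

theorem ω_pow_three : ω ^ 3 = 1 := by
  linear_combination (ω - 1) * ω_sq

theorem mk_eq (a b : ℤ) : (⟨a, b⟩ : EisensteinInt) = a + b * ω := by
  ext <;> simp [ω]

theorem star_ω : star ω = ω ^ 2 := by
  rw [ω_sq]; ext <;> simp [ω]

theorem absNorm_mul (x y : EisensteinInt) : absNorm (x * y) = absNorm x * absNorm y := by
  simp only [absNorm, map_mul, Int.natAbs_mul]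

theorem absNorm_natCast (n : ℕ) : absNorm (n : EisensteinInt) = n ^ 2 := by
  rw [absNorm, QuadraticAlgebra.norm_natCast, Int.natAbs_pow, Int.natAbs_natCast]

theorem absNorm_eq_one_iff {x : EisensteinInt} : absNorm x = 1 ↔ IsUnit x := by
  rw [QuadraticAlgebra.isUnit_iff_norm_isUnit, Int.isUnit_iff_natAbs_eq, absNorm]

theorem absNorm_dvd {x y : EisensteinInt} (h : x ∣ y) : absNorm x ∣ absNorm y := by
  obtain ⟨z, rfl⟩ := h
  exact ⟨_, absNorm_mul x z⟩

theorem absNorm_eq_of_associated {x y : EisensteinInt} (h : Associated x y) :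
    absNorm x = absNorm y :=
  Nat.dvd_antisymm (absNorm_dvd h.dvd) (absNorm_dvd h.symm.dvd)

theorem mul_star_eq_absNorm (x : EisensteinInt) : x * star x = (absNorm x : EisensteinInt) := by
  rw [← QuadraticAlgebra.algebraMap_norm_eq_mul_star, absNorm]
  have h : ((QuadraticAlgebra.norm x).natAbs : ℤ) = QuadraticAlgebra.norm x :=
    Int.natAbs_of_nonneg (norm_nonneg x)
  conv_lhs => rw [← h]
  simp

theorem natCast_dvd_mk_iff {n : ℕ} {z : EisensteinInt} :
    (n : EisensteinInt) ∣ z ↔ (n : ℤ) ∣ z.re ∧ (n : ℤ) ∣ z.im := by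
  constructor
  · rintro ⟨w, rfl⟩
    simp
  · rintro ⟨⟨a, ha⟩, ⟨b, hb⟩⟩
    refine ⟨⟨a, b⟩, ?_⟩
    ext <;> simp [ha, hb]

/-- The norm is (a+b)² - 3ab, a square modulo 3. Hence a prime p ≡ 2 (mod 3) is not a norm. -/
theorem absNorm_mod_three_ne_two (x : EisensteinInt) : absNorm x % 3 ≠ 2 := by
  intro h
  have h1 : (absNorm x : ℤ) = x.re ^ 2 - x.re * x.im + x.im ^ 2 := by
    rw [absNorm, Int.natAbs_of_nonneg (norm_nonneg x), norm_eq]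
  have h2 : (x.re ^ 2 - x.re * x.im + x.im ^ 2) % 3 = 2 := by rw [← h1]; lia
  have h3 : x.re ^ 2 - x.re * x.im + x.im ^ 2 =
      (x.re + x.im) ^ 2 + 3 * (-(x.re * x.im)) := by ring
  rw [h3, Int.add_mul_emod_self_left, pow_two, Int.mul_emod] at h2
  rcases (by lia : (x.re + x.im) % 3 = 0 ∨ (x.re + x.im) % 3 = 1 ∨ (x.re + x.im) % 3 = 2) with
    h | h | h <;> simp [h] at h2

theorem not_prime_natCast {p : ℕ} (hp : p.Prime) (h : p % 3 = 1) :
    ¬ Prime (p : EisensteinInt) := by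
  intro hpr
  have := Fact.mk hp
  -- An element of order 3 modulo p is a root of x² + x + 1, which splits over ℤ[ω] as (x - ω)(x + 1
  -- + ω); p divides neither factor because their ω-coordinates are ∓1.
  obtain ⟨u, hu⟩ := exists_prime_orderOf_dvd_card (G := (ZMod p)ˣ) 3 (by
    rw [ZMod.card_units_eq_totient, Nat.totient_prime hp]
    lia)
  have h1 : (u : ZMod p) ≠ 1 := by
    intro h
    rw [Units.val_eq_one] at h
    rw [h, orderOf_one] at hu
    lia
  have h3 : (u : ZMod p) ^ 3 = 1 := by
    rw [← Units.val_pow_eq_pow_val, ← hu, pow_orderOf_eq_one, Units.val_one]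
  have h2 : (u : ZMod p) ^ 2 + u + 1 = 0 := by
    refine (mul_eq_zero.1 ?_).resolve_left (sub_ne_zero.2 h1)
    linear_combination h3
  set x : ℕ := (u : ZMod p).val
  have hx : ((x : ℕ) : ZMod p) = u := ZMod.natCast_zmod_val _
  rw [← hx] at h2
  have hdvd : p ∣ x ^ 2 + x + 1 := by
    rw [← ZMod.natCast_eq_zero_iff]
    exact_mod_cast h2
  have hdvd' : (p : EisensteinInt) ∣ (x - ω) * (x + 1 + ω) := by
    obtain ⟨m, hm⟩ := hdvd
    refine ⟨m, ?_⟩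
    have := congrArg (Nat.cast (R := EisensteinInt)) hm
    push_cast at this
    linear_combination this - ω_sq
  have hp1 := hp.one_lt
  rcases hpr.dvd_or_dvd hdvd' with hd | hd
  · have := (natCast_dvd_mk_iff.1 hd).2
    simp [ω, Int.natAbs_dvd_natAbs.symm] at this
    lia
  · have := (natCast_dvd_mk_iff.1 hd).2
    simp [ω, Int.natAbs_dvd_natAbs.symm] at this
    lia

open UniqueFactorizationMonoid

/-- The factors have norms with product p², and each norm exceeds 1, so there is one prime of norm
p² or two of norm p. -/
theorem factors_natCast {p : ℕ} (hp : p.Prime) :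
    (∃ π, factors (p : EisensteinInt) = {π} ∧ Prime π ∧ absNorm π = p ^ 2 ∧
      Prime (p : EisensteinInt)) ∨
    (∃ π π', factors (p : EisensteinInt) = {π, π'} ∧ Prime π ∧ Prime π' ∧ absNorm π = p ∧
      absNorm π' = p ∧ (p : EisensteinInt) ∣ π * π') := by
  have hp0 : (p : EisensteinInt) ≠ 0 := by exact_mod_cast hp.ne_zero
  have hass := factors_prod hp0
  have hprime : ∀ π ∈ factors (p : EisensteinInt), Prime π := fun π h => prime_of_factor π h
  have hnorm : absNorm (factors (p : EisensteinInt)).prod = p ^ 2 := by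
    rw [absNorm_eq_of_associated hass, absNorm_natCast]
  generalize factors (p : EisensteinInt) = f at *
  have hunit : ∀ g : Multiset EisensteinInt, (∀ π ∈ g, Prime π) → absNorm g.prod = 1 → g = 0 := by
    intro g hg h
    refine Multiset.eq_zero_of_forall_notMem fun π hπ => (hg π hπ).not_isUnit ?_
    exact isUnit_of_dvd_unit (Multiset.dvd_prod hπ) (absNorm_eq_one_iff.1 h)
  have hcons : ∀ g : Multiset EisensteinInt, 1 < absNorm g.prod → ∃ π h, g = π ::ₘ h := by
    intro g hg
    obtain ⟨π, hπ⟩ := Multiset.exists_mem_of_ne_zero (s := g) (by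
      rintro rfl
      rw [Multiset.prod_zero, absNorm_eq_one_iff.2 isUnit_one] at hg
      exact lt_irrefl _ hg)
    exact ⟨π, Multiset.exists_cons_of_mem hπ⟩
  obtain ⟨π, g, rfl⟩ := hcons f (by rw [hnorm]; exact Nat.one_lt_pow two_ne_zero hp.one_lt)
  have hπ := hprime π (by simp)
  have hg : ∀ π ∈ g, Prime π := fun π h => hprime π (by simp [h])
  rw [Multiset.prod_cons] at hass hnorm
  rw [absNorm_mul] at hnorm
  obtain ⟨i, hi, hpi⟩ := (Nat.dvd_prime_pow hp).1 (Dvd.intro _ hnorm)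
  have hi0 : i ≠ 0 := by
    rintro rfl
    exact hπ.not_isUnit (absNorm_eq_one_iff.1 (by simpa using hpi))
  rcases (by lia : i = 1 ∨ i = 2) with rfl | rfl
  · right
    rw [pow_one] at hpi
    have hgn : absNorm g.prod = p := by
      rw [hpi, pow_two] at hnorm
      exact Nat.eq_of_mul_eq_mul_left hp.pos hnorm
    obtain ⟨π', g', rfl⟩ := hcons g (by rw [hgn]; exact hp.one_lt)
    have hπ' := hg π' (by simp)
    rw [Multiset.prod_cons, absNorm_mul] at hgn
    have hg1 := (hp.eq_one_or_self_of_dvd _ (Dvd.intro _ hgn)).resolve_left fun h =>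
      hπ'.not_isUnit (absNorm_eq_one_iff.1 h)
    rw [hg1] at hgn
    have := hunit g' (fun π h => hg π (by simp [h])) (Nat.eq_of_mul_eq_mul_left hp.pos
      (by rw [hgn, mul_one]))
    subst this
    exact ⟨π, π', rfl, hπ, hπ', hpi, hg1, by simpa using hass.symm.dvd⟩
  · left
    rw [hpi] at hnorm
    have := hunit g hg (Nat.eq_of_mul_eq_mul_left (pow_pos hp.pos 2) (by rw [hnorm, mul_one]))
    subst this
    rw [Multiset.prod_zero, mul_one] at hass
    exact ⟨π, rfl, hπ, hpi, hass.prime hπ⟩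

theorem exists_residueField {π : EisensteinInt} (hπ : Prime π) :
    ∃ (K : Type) (_ : Field K) (φ : EisensteinInt →+* K), ∀ x, φ x = 0 ↔ π ∣ x := by
  have : (Ideal.span {π}).IsMaximal := PrincipalIdealRing.isMaximal_of_irreducible hπ.irreducible
  exact ⟨_, Ideal.Quotient.field _, Ideal.Quotient.mk (Ideal.span {π}), fun x => by
    rw [Ideal.Quotient.eq_zero_iff_mem, Ideal.mem_span_singleton]⟩

/-! ### Frobenius and the cubic symbol in residue fields -/

section Frobenius

variable {K : Type*} [Field K] (φ : EisensteinInt →+* K) {p : ℕ}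

theorem map_eq (x : EisensteinInt) : φ x = x.re + x.im * φ ω := by
  conv_lhs => rw [show x = ⟨x.re, x.im⟩ from rfl, mk_eq]
  simp

/-- Frobenius fixes the integers, so only its effect on ω matters: trivial for p ≡ 1 (mod 3),
conjugation for p ≡ 2. -/
theorem map_pow_prime_of_mod_three_eq_one [CharP K p] (hp : p.Prime) (h : p % 3 = 1)
    (x : EisensteinInt) : φ x ^ p = φ x := by
  have := Fact.mk hp
  have h3 : φ ω ^ 3 = 1 := by rw [← map_pow, ω_pow_three, map_one]
  have hω : φ ω ^ p = φ ω := by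
    conv_lhs => rw [← Nat.div_add_mod p 3, h, pow_succ, pow_mul, h3, one_pow, one_mul]
  have := map_eq φ x
  rw [this, ← frobenius_def, map_add, map_mul, map_intCast, map_intCast, frobenius_def, hω]

theorem map_pow_prime_of_mod_three_eq_two [CharP K p] (hp : p.Prime) (h : p % 3 = 2)
    (x : EisensteinInt) : φ x ^ p = φ (star x) := by
  have := Fact.mk hp
  have h3 : φ ω ^ 3 = 1 := by rw [← map_pow, ω_pow_three, map_one]
  have hω : φ ω ^ p = φ (star ω) := by
    conv_lhs => rw [← Nat.div_add_mod p 3, h, pow_add, pow_mul, h3, one_pow, one_mul]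
    rw [star_ω, map_pow]
  have h1 : star x = x.re + x.im * star ω := by
    ext <;> simp [ω]
  rw [map_eq φ x, ← frobenius_def, map_add, map_mul, map_intCast, map_intCast, frobenius_def, hω,
    h1]
  simp

end Frobenius

/-- The set `{1, ω, ω ^ 2}` of values of the cubic residue symbol at invertible arguments. -/
def IsCubicRootOfUnity (x : EisensteinInt) : Prop := x = 1 ∨ x = ω ∨ x = ω ^ 2

theorem IsCubicRootOfUnity.mul {x y : EisensteinInt} (hx : IsCubicRootOfUnity x)
    (hy : IsCubicRootOfUnity y) : IsCubicRootOfUnity (x * y) := by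
  have h3 := ω_pow_three
  rcases hx with rfl | rfl | rfl
  · rwa [one_mul]
  · rcases hy with rfl | rfl | rfl
    · exact Or.inr (Or.inl (mul_one _))
    · exact Or.inr (Or.inr (pow_two _).symm)
    · exact Or.inl (by rw [← pow_succ', h3])
  · rcases hy with rfl | rfl | rfl
    · exact Or.inr (Or.inr (mul_one _))
    · exact Or.inl (by rw [← pow_succ, h3])
    · exact Or.inr (Or.inl (by linear_combination ω * h3))

theorem IsCubicRootOfUnity.mul_star {x : EisensteinInt} (hx : IsCubicRootOfUnity x) :
    x * star x = 1 := by
  have h3 := ω_pow_three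
  rcases hx with rfl | rfl | rfl
  · simp
  · rw [star_ω, ← pow_succ', h3]
  · rw [star_pow, star_ω, ← mul_pow, ← pow_succ', h3, one_pow]

/-- X³ - 1 = (X-1)(X-ω)(X-ω²), so the Fermat-type hypothesis `h3` excludes the default value 0. -/
theorem cubicResidueSymbol_spec {π α : EisensteinInt} (hπ : Prime π) (h : ¬ π ∣ α)
    (h3 : π ∣ α ^ ((absNorm π - 1) / 3 * 3) - 1) :
    IsCubicRootOfUnity (cubicResidueSymbol α π) ∧
      π ∣ α ^ ((absNorm π - 1) / 3) - cubicResidueSymbol α π := by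
  unfold cubicResidueSymbol
  set m := (absNorm π - 1) / 3
  have hfac : α ^ (m * 3) - 1 = (α ^ m - 1) * ((α ^ m - ω) * (α ^ m - ω ^ 2)) := by
    rw [ω_sq, pow_mul]
    linear_combination (α ^ m - 1) * ω_sq
  rw [hfac] at h3
  rw [if_neg h]
  split_ifs with h1 h2 h4
  · exact ⟨Or.inl rfl, h1⟩
  · exact ⟨Or.inr (Or.inl rfl), h2⟩
  · exact ⟨Or.inr (Or.inr rfl), h4⟩
  · rcases hπ.dvd_or_dvd h3 with h | h
    · exact absurd h h1
    · exact ((hπ.dvd_or_dvd h).elim h2 h4).elim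

end EisensteinInt

namespace EisensteinInt

open UniqueFactorizationMonoid

section CubicSymbol

variable {K : Type*} [Field K] {φ : EisensteinInt →+* K} {π : EisensteinInt} {p : ℕ}

theorem charP_of_dvd (hφ : ∀ x, φ x = 0 ↔ π ∣ x) (hp : p.Prime) (h : π ∣ (p : EisensteinInt)) :
    CharP K p :=
  (CharP.charP_iff_prime_eq_zero hp).2 (by rw [← map_natCast φ, hφ]; exact h)

theorem map_cubicResidueSymbol (hπ : Prime π) (hφ : ∀ x, φ x = 0 ↔ π ∣ x) {α : EisensteinInt}
    (hα : φ α ≠ 0) {m : ℕ} (hm : absNorm π - 1 = m * 3) (h : φ α ^ (m * 3) = 1) :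
    IsCubicRootOfUnity (cubicResidueSymbol α π) ∧ φ (cubicResidueSymbol α π) = φ α ^ m := by
  have hdiv : (absNorm π - 1) / 3 = m := by lia
  have := cubicResidueSymbol_spec (α := α) hπ (by rwa [Ne, hφ] at hα) (by
    rw [hdiv, ← hφ, map_sub, map_pow, h, map_one, sub_self])
  rw [hdiv, ← hφ, map_sub, sub_eq_zero, map_pow] at this
  exact ⟨this.1, this.2.symm⟩

theorem map_pow_sub_one_of_mod_three_eq_one [CharP K p] (hp : p.Prime) (h : p % 3 = 1)
    {α : EisensteinInt} (hα : φ α ≠ 0) : φ α ^ (p / 3 * 3) = 1 := by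
  have h1 := map_pow_prime_of_mod_three_eq_one φ hp h α
  rw [show p = p / 3 * 3 + 1 by lia, pow_succ] at h1
  exact mul_right_cancel₀ hα (by rw [h1, one_mul])

theorem map_pow_sq_sub_one_of_mod_three_eq_two [CharP K p] (hp : p.Prime) (h : p % 3 = 2)
    {α : EisensteinInt} (hα : φ α ≠ 0) : φ α ^ ((p - 1) * (p / 3 + 1) * 3) = 1 := by
  have h1 : φ α ^ (p * p) = φ α := by
    rw [pow_mul, map_pow_prime_of_mod_three_eq_two φ hp h,
      map_pow_prime_of_mod_three_eq_two φ hp h, star_star]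
  have h2 : p * p = (p - 1) * (p / 3 + 1) * 3 + 1 := by
    rw [mul_assoc, show (p / 3 + 1) * 3 = p + 1 by lia]
    obtain ⟨q, rfl⟩ := Nat.exists_eq_add_of_lt hp.pos
    simp only [zero_add, Nat.add_sub_cancel]
    ring
  rw [h2, pow_succ] at h1
  exact mul_right_cancel₀ hα (by rw [h1, one_mul])

end CubicSymbol

/-- A residue field `K` of `ℤ[ω]` above `p`, in which the cubic Jacobi symbol modulo `p` is
expressed by `(p / 3)`-th powers. -/
theorem exists_field_map_cubicJacobiSymbol {p : ℕ} (hp : p.Prime) (hp3 : 3 < p) :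
    ∃ (K : Type) (_ : Field K) (φ : EisensteinInt →+* K), CharP K p ∧
      ∀ α, φ α ≠ 0 → φ (star α) ≠ 0 →
        IsCubicRootOfUnity (cubicJacobiSymbol α (p : EisensteinInt)) ∧
        ((φ (cubicJacobiSymbol α (p : EisensteinInt)) * φ (star α) ^ (p / 3) = φ α ^ (p / 3)) ∨
          (φ (cubicJacobiSymbol α (p : EisensteinInt)) * φ α ^ (p / 3 + 1) =
            φ (star α) ^ (p / 3 + 1))) := by
  have hp0 : p % 3 ≠ 0 := fun h => by
    have := (Nat.prime_dvd_prime_iff_eq Nat.prime_three hp).1 (Nat.dvd_of_mod_eq_zero h)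
    lia
  rcases factors_natCast hp with ⟨π, hf, hπ, hN, hpp⟩ | ⟨π, π', hf, hπ, hπ', hN, hN', hdvd⟩
  · have hmod : p % 3 = 2 := by
      by_contra h
      exact not_prime_natCast hp (by lia) hpp
    obtain ⟨K, _, φ, hφ⟩ := exists_residueField hπ
    have hchar := charP_of_dvd hφ hp (dvd_of_mem_factors (by rw [hf]; simp))
    refine ⟨K, _, φ, hchar, fun α hα _ => ?_⟩
    have hpow := map_pow_sq_sub_one_of_mod_three_eq_two hp hmod hα
    have hm : absNorm π - 1 = (p - 1) * (p / 3 + 1) * 3 := by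
      rw [hN, mul_assoc, show (p / 3 + 1) * 3 = p + 1 by lia]
      obtain ⟨q, rfl⟩ := Nat.exists_eq_add_of_lt hp.pos
      simp only [zero_add, Nat.add_sub_cancel]
      rw [show (q + 1) ^ 2 = q * (q + 1 + 1) + 1 by ring, Nat.add_sub_cancel]
    obtain ⟨h1, h2⟩ := map_cubicResidueSymbol hπ hφ hα hm hpow
    rw [cubicJacobiSymbol, hf, Multiset.map_singleton, Multiset.prod_singleton]
    refine ⟨h1, Or.inr ?_⟩
    -- With (Nπ-1)/3 = (p-1)(n+1) and α^p = star α in K, the symbol is (star α / α)^(n+1).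
    rw [h2, pow_mul, ← mul_pow, ← pow_succ, Nat.sub_add_cancel hp.one_le,
      map_pow_prime_of_mod_three_eq_two φ hp hmod]
  · have hmod : p % 3 = 1 := by
      have := absNorm_mod_three_ne_two π
      rw [hN] at this
      lia
    have hm : p - 1 = p / 3 * 3 := by lia
    obtain ⟨K, _, φ, hφ⟩ := exists_residueField hπ
    obtain ⟨K', _, φ', hφ'⟩ := exists_residueField hπ'
    have hchar := charP_of_dvd hφ hp (dvd_of_mem_factors (by rw [hf]; simp))
    have hchar' := charP_of_dvd hφ' hp (dvd_of_mem_factors (by rw [hf]; simp))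
    -- The symbol modulo π' lives in another residue field; conjugation carries congruences modulo
    -- π' to congruences modulo π.
    have hstar : star π ∣ π' := by
      rw [← hN, ← mul_star_eq_absNorm] at hdvd
      exact (mul_dvd_mul_iff_left hπ.ne_zero).1 hdvd
    have hstar' : ∀ x, φ' x = 0 → φ (star x) = 0 := by
      intro x hx
      obtain ⟨y, rfl⟩ := hstar.trans ((hφ' x).1 hx)
      rw [hφ, star_mul', star_star]
      exact dvd_mul_right _ _
    refine ⟨K, _, φ, hchar, fun α hα hα' => ?_⟩
    have hα'' : φ' α ≠ 0 := fun h => hα' (hstar' α h)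
    obtain ⟨h1, h2⟩ := map_cubicResidueSymbol hπ hφ hα (by rw [hN, hm])
      (map_pow_sub_one_of_mod_three_eq_one hp hmod hα)
    obtain ⟨h1', h2'⟩ := map_cubicResidueSymbol hπ' hφ' hα'' (by rw [hN', hm])
      (map_pow_sub_one_of_mod_three_eq_one hp hmod hα'')
    have h3 := hstar' (cubicResidueSymbol α π' - α ^ (p / 3)) (by
      rw [map_sub, h2', map_pow, sub_self])
    rw [star_sub, star_pow, map_sub, map_pow, sub_eq_zero] at h3
    rw [cubicJacobiSymbol, hf, Multiset.insert_eq_cons, Multiset.map_cons, Multiset.map_singleton,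
      Multiset.prod_cons, Multiset.prod_singleton]
    refine ⟨h1.mul h1', Or.inl ?_⟩
    -- The conjugate of the symbol at π' maps to (star α)^n, and a cube root of unity times its
    -- conjugate is 1.
    rw [← h3, map_mul, mul_assoc, ← map_mul, h1'.mul_star, map_one, mul_one, h2]

end EisensteinInt

/-! ### Evaluation of the sum -/

theorem Rat.ReducesTo.unique {K : Type*} [Field K] {x : ℚ} {k l : K} (hk : x.ReducesTo k)
    (hl : x.ReducesTo l) : k = l := by
  obtain ⟨a, d, hd, h1, h2⟩ := hk
  obtain ⟨a', d', hd', h1', h2'⟩ := hl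
  have h : a * d' = a' * d := by
    have : (a * d' : ℚ) = a' * d := by rw [← h1, ← h1']; ring
    exact_mod_cast this
  have h' : (a : K) * d' = a' * d := by exact_mod_cast congrArg (Int.cast (R := K)) h
  rw [← h2, ← h2'] at h'
  apply mul_right_cancel₀ (mul_ne_zero hd hd')
  linear_combination h'

theorem IsPIntegral.den_ne_zero {K : Type*} [Field K] {p : ℕ} [CharP K p] {x : ℚ}
    (hx : IsPIntegral p x) : (x.den : K) ≠ 0 := by
  rwa [Ne, CharP.cast_eq_zero_iff K p]

theorem IsPIntegral.reducesTo {K : Type*} [Field K] {p : ℕ} [CharP K p] {x : ℚ}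
    (hx : IsPIntegral p x) : x.ReducesTo (x.num / x.den : K) :=
  ⟨x.num, x.den, by simpa using hx.den_ne_zero (K := K), by simp,
    by simpa using div_mul_cancel₀ _ (hx.den_ne_zero (K := K))⟩

theorem sum_choose_three_mul_eq {K : Type*} [Field K] {p : ℕ} [CharP K p] (hp : p.Prime)
    (hp3 : 3 < p) {c s ρ : K} (hs : s ^ 2 = -3) (hc : c ≠ 0) (h2 : (2 : K) ≠ 0) (h3 : (3 : K) ≠ 0)
    (h1 : c + s ≠ 0) (h1' : c - s ≠ 0)
    (hρ : ρ * (c - s) ^ (p / 3) = (c + s) ^ (p / 3) ∨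
      ρ * (c + s) ^ (p / 3 + 1) = (c - s) ^ (p / 3 + 1)) :
    ∑ k ∈ Finset.Icc 1 (p / 3), ((3 * k).choose k : K) * (4 / (9 * (c ^ 2 + 3))) ^ k =
      ((c + s) * ρ + (c - s) * ρ⁻¹) / (2 * c) - 1 := by
  have hfac : c ^ 2 + 3 = (c - s) * (c + s) := by linear_combination hs
  set v := (c + s) / (c - s) with hv
  have hv0 : v ≠ 0 := div_ne_zero h1 h1'
  have hv1 : v + 1 = 2 * c / (c - s) := by rw [hv]; field_simp; ring
  have h9 : (9 : K) ≠ 0 := by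
    rw [show (9 : K) = 3 * 3 by norm_num]
    exact mul_ne_zero h3 h3
  -- v - 1 = 2s/(c-s), so (v-1)²/v = 4s²/(c²+3) = -12/(c²+3).
  have hy : -27 * (4 / (9 * (c ^ 2 + 3))) * v = (v - 1) ^ 2 := by
    rw [hfac, hv]
    field_simp
    linear_combination -36 * hs
  have hsum := one_add_sum_choose_three_mul hp hp3 (4 / (9 * (c ^ 2 + 3)))
  have hclosed := (morganVoyce_closed_form hv0 hy (p / 3)).1
  rw [← hsum] at hclosed
  -- If ρ = v^n the summands match in order; if ρ = v^(-(n+1)) they are exchanged.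
  have hval : v ^ (p / 3 + 1) + (v ^ (p / 3))⁻¹ = v * ρ + ρ⁻¹ := by
    rcases hρ with h | h
    · have : ρ = v ^ (p / 3) := by
        rw [hv, div_pow, ← h, mul_div_cancel_right₀ _ (pow_ne_zero _ h1')]
      rw [this, pow_succ']
    · have : ρ = (v ^ (p / 3 + 1))⁻¹ := by
        rw [hv, div_pow, inv_div, ← h, mul_div_cancel_right₀ _ (pow_ne_zero _ h1)]
      rw [this, inv_inv, add_comm, pow_succ', mul_inv, mul_inv_cancel_left₀ hv0]
  rw [hval, hv1, hv] at hclosed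
  rw [eq_sub_iff_add_eq', eq_div_iff (mul_ne_zero h2 hc)]
  have := congrArg (· * (c - s)) hclosed
  beta_reduce at this
  rw [div_mul_eq_mul_div, div_mul_cancel₀ _ h1', add_mul, div_mul_eq_mul_div,
    div_mul_cancel₀ _ h1'] at this
  linear_combination this

theorem theorem2p5 (p : ℕ) (hp : p.Prime) (hp3 : 3 < p) (c : ℚ) (hc : IsPIntegral p c)
    (hc0 : ¬ RatModEq p (c * (c ^ 2 + 3)) 0) :
    (c ∈ cubicClass 0 p ∨ c ∈ cubicClass 1 p ∨ c ∈ cubicClass 2 p) ∧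
    (c ∈ cubicClass 0 p →
      RatModEq p
        (∑ k ∈ Finset.Icc 1 (p / 3), (Nat.choose (3 * k) k : ℚ) * (4 / (9 * (c ^ 2 + 3))) ^ k)
        0) ∧
    (c ∈ cubicClass 1 p →
      RatModEq p
        (∑ k ∈ Finset.Icc 1 (p / 3), (Nat.choose (3 * k) k : ℚ) * (4 / (9 * (c ^ 2 + 3))) ^ k)
        (-(3 * (c + 1) / (2 * c)))) ∧
    (c ∈ cubicClass 2 p →
      RatModEq p
        (∑ k ∈ Finset.Icc 1 (p / 3), (Nat.choose (3 * k) k : ℚ) * (4 / (9 * (c ^ 2 + 3))) ^ k)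
        (-(3 * (c - 1) / (2 * c)))) := by
  obtain ⟨K, _, φ, _, hJ⟩ := EisensteinInt.exists_field_map_cubicJacobiSymbol hp hp3
  have h2 : (2 : K) ≠ 0 := by
    have : ((2 : ℕ) : K) ≠ 0 := by
      rw [Ne, CharP.cast_eq_zero_iff K p]
      exact Nat.not_dvd_of_pos_of_lt (by lia) (by lia)
    exact_mod_cast this
  have h3 : (3 : K) ≠ 0 := by
    have : ((3 : ℕ) : K) ≠ 0 := by
      rw [Ne, CharP.cast_eq_zero_iff K p]
      exact Nat.not_dvd_of_pos_of_lt (by lia) (by lia)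
    exact_mod_cast this
  obtain ⟨C, hC⟩ : ∃ C : K, c.ReducesTo C := ⟨_, hc.reducesTo⟩
  have hprod : C * (C ^ 2 + 3) ≠ 0 := fun h => hc0 (Rat.ReducesTo.ratModEq (K := K)
    (h ▸ hC.mul ((hC.pow 2).add (Rat.ReducesTo.ofNat 3))) Rat.ReducesTo.zero)
  obtain ⟨hC0, hC3⟩ := mul_ne_zero_iff.1 hprod
  set W := φ EisensteinInt.ω
  have hW : W ^ 2 = -1 - W := by
    rw [← map_pow, EisensteinInt.ω_sq, map_sub, map_neg, map_one]
  set S := 1 + 2 * W with hSdef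
  have hS : S ^ 2 = -3 := by rw [hSdef]; linear_combination 4 * hW
  have hfac : (C - S) * (C + S) ≠ 0 := by
    rwa [show (C - S) * (C + S) = C ^ 2 + 3 by linear_combination -hS]
  obtain ⟨hCS', hCS⟩ := mul_ne_zero_iff.1 hfac
  have hc1 : IsPIntegral p (c + 1) := fun h => hc (by simpa using h.trans (Rat.add_den_dvd c 1))
  have hD := hc1.den_ne_zero (K := K)
  have hN : ((c + 1).num : K) = (c + 1).den * (C + 1) := by
    rw [← hc1.reducesTo.unique (hC.add Rat.ReducesTo.one), mul_div_cancel₀ _ hD]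
  -- `α` and `d` are exactly the numerator and denominator used by `cubicJacobiSymbolRat`, so
  -- `hsymb` is definitional.
  set α : EisensteinInt := ⟨(c + 1).num * ((2 : ℚ).den : ℤ), (2 : ℚ).num * ((c + 1).den : ℤ)⟩
    with hαdef
  set d : EisensteinInt := (((c + 1).den * (2 : ℚ).den : ℕ) : EisensteinInt) with hd
  have hφα : φ α = (c + 1).den * (C + S) := by
    rw [hαdef, EisensteinInt.map_eq]
    simp only [Rat.den_ofNat, Rat.num_ofNat]
    push_cast
    rw [hN]
    ring
  have hφα' : φ (star α) = (c + 1).den * (C - S) := by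
    rw [hαdef, EisensteinInt.map_eq]
    simp only [QuadraticAlgebra.star_mk, Rat.den_ofNat, Rat.num_ofNat]
    push_cast
    rw [hN]
    ring
  have hφd : φ d = (c + 1).den := by simp [hd]
  have hstar : star d = d := by rw [hd, star_natCast]
  obtain ⟨hα, hαρ⟩ := hJ α (by rw [hφα]; exact mul_ne_zero hD hCS)
    (by rw [hφα']; exact mul_ne_zero hD hCS')
  obtain ⟨hdu, hdρ⟩ := hJ d (by rwa [hφd]) (by rwa [hstar, hφd])
  -- As `d` is its own conjugate, both alternatives force its symbol to be 1 in K.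
  have hd1 : φ (EisensteinInt.cubicJacobiSymbol d (p : EisensteinInt)) = 1 := by
    rw [hstar, hφd] at hdρ
    rcases hdρ with h | h <;> exact mul_right_cancel₀ (pow_ne_zero _ hD) (by rw [h, one_mul])
  have hsymb : EisensteinInt.cubicJacobiSymbolRat ⟨c + 1, 2⟩ (p : EisensteinInt) =
      EisensteinInt.cubicJacobiSymbol α p * EisensteinInt.cubicJacobiSymbol d p ^ 2 := rfl
  have hmem : ∀ r, c ∈ cubicClass r p ↔
      EisensteinInt.cubicJacobiSymbolRat ⟨c + 1, 2⟩ (p : EisensteinInt) = EisensteinInt.ω ^ r := by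
    -- The condition c² + 3 ≢ 0 in `cubicClass` already follows from `hc0`.
    refine fun r => ⟨fun h => h.2.2, fun h => ⟨hc, ?_, h⟩⟩
    rintro ⟨z, hz, h⟩
    refine hc0 ⟨c * z, Rat.ReducesTo.isPIntegral_mul hp hc hz, ?_⟩
    linear_combination c * h
  have hsum : ∀ r, c ∈ cubicClass r p → Rat.ReducesTo
      (∑ k ∈ Finset.Icc 1 (p / 3), (Nat.choose (3 * k) k : ℚ) * (4 / (9 * (c ^ 2 + 3))) ^ k)
      (((C + S) * W ^ r + (C - S) * (W ^ r)⁻¹) / (2 * C) - 1) := by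
    intro r hr
    rw [hmem, hsymb] at hr
    have hr := congrArg φ hr
    rw [map_mul, map_pow, hd1, one_pow, mul_one, map_pow] at hr
    rw [hr, hφα, hφα'] at hαρ
    rw [← sum_choose_three_mul_eq hp hp3 hS hC0 h2 h3 hCS hCS' (ρ := W ^ r)]
    · refine Rat.ReducesTo.sum _ fun k _ => (Rat.ReducesTo.natCast _).mul (.pow (.div (.ofNat 4)
        (.mul (.ofNat 9) ((hC.pow 2).add (.ofNat 3))) ?_) k)
      rw [show (9 : K) = 3 * 3 by norm_num]
      exact mul_ne_zero (mul_ne_zero h3 h3) hC3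
    -- Both sides carry the same power of the denominator of c + 1, which cancels.
    · refine hαρ.imp (fun h => ?_) fun h => ?_ <;> rw [mul_pow, mul_pow] at h <;>
        refine mul_left_cancel₀ (pow_ne_zero _ hD) (Eq.trans ?_ h) <;> ring
  have hWinv : W⁻¹ = W ^ 2 := by
    refine inv_eq_of_mul_eq_one_right ?_
    linear_combination (W - 1) * hW
  have hWinv2 : (W ^ 2)⁻¹ = W := by rw [← hWinv, inv_inv]
  have h2C := mul_ne_zero h2 hC0
  refine ⟨?_, fun h => ?_, fun h => ?_, fun h => ?_⟩
  · rw [hmem, hmem, hmem, hsymb, pow_zero, pow_one]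
    exact hα.mul (pow_two (EisensteinInt.cubicJacobiSymbol d p) ▸ hdu.mul hdu)
  · refine Rat.ReducesTo.ratModEq (K := K) (hsum 0 h) ?_
    convert Rat.ReducesTo.zero (K := K) using 1
    field_simp
    ring
  · refine Rat.ReducesTo.ratModEq (K := K) (hsum 1 h) ?_
    convert (((Rat.ReducesTo.ofNat 3).mul (hC.add .one)).div ((Rat.ReducesTo.ofNat 2).mul hC)
      h2C).neg using 1
    -- The numerator is (C+S)ω + (C-S)ω² = -C + S² = -C - 3, since ω - ω² = S.
    rw [pow_one, hWinv, hW, hSdef]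
    field_simp
    linear_combination 4 * hW
  · refine Rat.ReducesTo.ratModEq (K := K) (hsum 2 h) ?_
    convert (((Rat.ReducesTo.ofNat 3).mul (hC.sub .one)).div ((Rat.ReducesTo.ofNat 2).mul hC)
      h2C).neg using 1
    rw [hWinv2, hW, hSdef]
    field_simp
    linear_combination -4 * hW
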